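/- For real $p,r$ let $A_0(p,r)=1$ and $A_m(p,r)=\frac{r}{m!}\prod_{i=1}^{m-1}(mp+r-i)$ for $m\ge1$ (the Raney numbers), and let $\mu(p,r)$ denote the probability measure on $\mathbb{R}$ whose moment sequence is $\left(A_m(p,r)\right)_{m\ge0}$, when it exists. For $p=3$ and $r\in\{1,2,3\}$ the measure $\mu(3,r)$ exists, is unique, is concentrated on $(0,27/4)$ and is absolutely continuous. Let $W_{3,r}$ be its density, taken as the derivative of the distribution function $t\mapsto\mu(3,r)((-\infty,t])$. Then for every $x\in(0,27/4)$ $$W_{3,1}(x)=\frac{3\left(1+\sqrt{1-4x/27}\right)^{2/3}-2^{2/3}x^{1/3}}{2^{4/3}3^{1/2}\pi x^{2/3}\left(1+\sqrt{1-4x/27}\right)^{1/3}},$$ $$W_{3,2}(x)=\frac{9\left(1+\sqrt{1-4x/27}\right)^{4/3}-2^{4/3}x^{2/3}}{2^{5/3}3^{3/2}\pi x^{1/3}\left(1+\sqrt{1-4x/27}\right)^{2/3}},$$ and $W_{3,3}(x)=x\cdot W_{3,1}(x)$. -/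

import Mathlib

open MeasureTheory Set
open scoped Nat

/-- The Raney numbers (two-parameter Fuss-Catalan numbers): `A_0(p,r) = 1` and
`A_m(p,r) = (r / m!) * ∏_{i=1}^{m-1} (m p + r - i)` for `m ≥ 1`. -/
noncomputable def raneyNumber (p r : ℝ) (m : ℕ) : ℝ :=
  if m = 0 then 1
  else r / (m ! : ℝ) * ∏ i ∈ Finset.Icc 1 (m - 1), ((m : ℝ) * p + r - (i : ℝ))

/-- `μ` is a probability measure on the real line all of whose moments are finite and whose
moment sequence is the sequence of Raney numbers `A_m(p,r)`. -/
structure IsRaneyMeasure (p r : ℝ) (μ : Measure ℝ) : Prop where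
  isProbabilityMeasure : IsProbabilityMeasure μ
  integrable_pow : ∀ m : ℕ, Integrable (fun x : ℝ => x ^ m) μ
  moment_eq : ∀ m : ℕ, ∫ x : ℝ, x ^ m ∂μ = raneyNumber p r m

open Classical in
/-- The Raney distribution `μ(p,r)`: the probability measure with moments `A_m(p,r)`
(the zero measure if there is none). -/
noncomputable def raneyMeasure (p r : ℝ) : Measure ℝ :=
  if h : ∃ μ : Measure ℝ, IsRaneyMeasure p r μ then h.choose else 0

/-- The density function `W_{p,r}` of `μ(p,r)`, as the derivative of the distribution
function `t ↦ μ(p,r)((-∞, t])`. This fixes the value of the density at every point of continuity. -/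
noncomputable def raneyDensity (p r : ℝ) (x : ℝ) : ℝ :=
  deriv (fun t : ℝ => (raneyMeasure p r).real (Iic t)) x

/-! Substitute x = 27 t (1 - t) with t in (1/2, 1). Then 1 + √(1 - 4x/27) = 2t, and the formulas for
r = 1, 2 become multiples of t^a (1-t)^b - t^b (1-t)^a. The Jacobian factor 2t - 1 = t - (1 - t)
turns each moment into an integral of H(t) + H(1-t) over (1/2, 1), hence of H over (0, 1): a
difference of two beta integrals (`moments_of_quadratic_subst`). Gauss triplication
(`Gamma_thirds_mul`) converts the Gamma values into the factorial form of the Raney numbers.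

Moments determine a compactly supported measure (`eq_of_integral_pow_eq`), so the constructed
measure is μ(3,r), and continuity of its density lets the distribution function be differentiated
(`raneyMeasure_of_density`). For r = 3, A_m(3,3) = A_{m+1}(3,1), so multiplying the density for r =
1 by x suffices. -/

/-! ### Moment determinacy under bounded support -/

theorem ae_abs_le_of_integral_pow_le {μ : Measure ℝ} [IsFiniteMeasure μ] {R : ℝ} (hR : 0 ≤ R)
    (hint : ∀ m : ℕ, Integrable (fun x : ℝ => x ^ m) μ)
    (h : ∀ m : ℕ, ∫ x, x ^ (2 * m) ∂μ ≤ R ^ (2 * m)) : ∀ᵐ x ∂μ, |x| ≤ R := by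
  -- Markov's inequality for x^(2m) bounds this mass by (R/S)^(2m), which tends to 0.
  have key : ∀ S : ℝ, R < S → μ.real {x | S ≤ |x|} = 0 := by
    intro S hS
    have hS0 : 0 < S := hR.trans_lt hS
    have hle : ∀ m : ℕ, μ.real {x | S ≤ |x|} ≤ ((R / S) ^ 2) ^ m := by
      intro m
      have hsub : {x : ℝ | S ≤ |x|} ⊆ {x | S ^ (2 * m) ≤ x ^ (2 * m)} := by
        intro x hx
        have : S ^ (2 * m) ≤ |x| ^ (2 * m) := pow_le_pow_left₀ hS0.le hx _
        rwa [(even_two_mul m).pow_abs] at this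
      have h1 := mul_meas_ge_le_integral_of_nonneg
        (Filter.Eventually.of_forall fun x : ℝ => (even_two_mul m).pow_nonneg x)
        (hint (2 * m)) (S ^ (2 * m))
      have h2 : S ^ (2 * m) * μ.real {x | S ≤ |x|} ≤ R ^ (2 * m) :=
        (mul_le_mul_of_nonneg_left (measureReal_mono hsub) (by positivity)).trans (h1.trans (h m))
      rw [← pow_mul, div_pow, le_div_iff₀ (by positivity), mul_comm]
      exact h2
    have hlim : Filter.Tendsto (fun m : ℕ => ((R / S) ^ 2) ^ m) Filter.atTop (nhds 0) :=
      tendsto_pow_atTop_nhds_zero_of_lt_one (by positivity)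
        (pow_lt_one₀ (by positivity) ((div_lt_one hS0).2 hS) two_ne_zero)
    exact le_antisymm (ge_of_tendsto' hlim hle) measureReal_nonneg
  have hall : ∀ᵐ x ∂μ, ∀ n : ℕ, |x| < R + 1 / ((n : ℝ) + 1) := by
    rw [ae_all_iff]
    intro n
    have := key (R + 1 / ((n : ℝ) + 1)) (by linarith [Nat.one_div_pos_of_nat (α := ℝ) (n := n)])
    rw [measureReal_eq_zero_iff] at this
    rw [ae_iff]
    simpa only [not_lt] using this
  filter_upwards [hall] with x hx
  have hlim : Filter.Tendsto (fun n : ℕ => R + 1 / ((n : ℝ) + 1)) Filter.atTop (nhds R) := by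
    simpa using (tendsto_one_div_add_atTop_nhds_zero_nat (𝕜 := ℝ)).const_add R
  exact ge_of_tendsto' hlim fun n => (hx n).le

/-- The exponential series integrates termwise, dominated by (|t| R)^n / n!; the characteristic
function therefore depends on the moments alone. -/
theorem hasSum_charFun {μ : Measure ℝ} [IsFiniteMeasure μ] {R : ℝ} (hμ : ∀ᵐ x ∂μ, |x| ≤ R)
    (t : ℝ) :
    HasSum (fun n : ℕ => ((t * Complex.I) ^ n / (n ! : ℂ)) * ((∫ x, x ^ n ∂μ : ℝ) : ℂ))
      (charFun μ t) := by
  rw [charFun_apply_real]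
  have := hasSum_integral_of_dominated_convergence (μ := μ)
    (F := fun (n : ℕ) (x : ℝ) => ((t * Complex.I) ^ n / (n ! : ℂ)) * ((x ^ n : ℝ) : ℂ))
    (f := fun x : ℝ => Complex.exp (t * x * Complex.I))
    (fun n _ => (|t| * R) ^ n / n !) (fun n => by fun_prop) (fun n => ?_)
    (.of_forall fun _ => Real.summable_pow_div_factorial _) (integrable_const _)
    (.of_forall fun x => ?_)
  · simp only [integral_const_mul, integral_complex_ofReal] at this
    exact this
  · filter_upwards [hμ] with x hx
    have : |x| ^ n ≤ R ^ n := pow_le_pow_left₀ (abs_nonneg x) hx n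
    simp only [norm_mul, norm_div, norm_pow, Complex.norm_I, mul_one, Complex.norm_natCast,
      Complex.norm_real, Real.norm_eq_abs, mul_pow, one_pow]
    rw [div_mul_eq_mul_div]
    gcongr
  · have := NormedSpace.expSeries_div_hasSum_exp ((t * x * Complex.I : ℂ))
    rw [← Complex.exp_eq_exp_ℂ] at this
    refine this.congr_fun fun n => ?_
    push_cast
    ring

/-- A compactly supported probability measure is determined by its moments. -/
theorem eq_of_integral_pow_eq {μ ν : Measure ℝ} [IsProbabilityMeasure μ] [IsProbabilityMeasure ν]
    {R : ℝ} (hμ : ∀ᵐ x ∂μ, |x| ≤ R) (hν : ∀ m : ℕ, Integrable (fun x : ℝ => x ^ m) ν)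
    (h : ∀ m : ℕ, ∫ x, x ^ m ∂μ = ∫ x, x ^ m ∂ν) : μ = ν := by
  have hR : 0 ≤ R := by
    obtain ⟨x, hx⟩ := hμ.exists
    exact (abs_nonneg x).trans hx
  have hν' : ∀ᵐ x ∂ν, |x| ≤ R := by
    refine ae_abs_le_of_integral_pow_le hR hν fun m => ?_
    rw [← h]
    have : ∫ x, x ^ (2 * m) ∂μ ≤ ∫ _, R ^ (2 * m) ∂μ := by
      refine integral_mono_of_nonneg (.of_forall fun x => (even_two_mul m).pow_nonneg x)
        (integrable_const _) ?_
      filter_upwards [hμ] with x hx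
      rw [← (even_two_mul m).pow_abs x]
      exact pow_le_pow_left₀ (abs_nonneg x) hx _
    simpa using this
  refine Measure.ext_of_charFun (funext fun t => ?_)
  have h1 := hasSum_charFun hμ t
  simp only [h] at h1
  exact h1.unique (hasSum_charFun hν' t)

/-! ### Raney numbers as factorial quotients -/

theorem prod_Icc_sub_mul_factorial (N k : ℕ) :
    (∏ i ∈ Finset.Icc 1 k, ((N + k + 1 : ℝ) - i)) * (N ! : ℝ) = ((N + k)! : ℝ) := by
  induction k generalizing N with
  | zero => simp
  | succ k ih =>
    have h := ih (N + 1)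
    rw [Finset.prod_Icc_succ_top (by omega), show N + (k + 1) = N + 1 + k by ring, ← h,
      Nat.factorial_succ]
    push_cast
    rw [show ((N : ℝ) + (k + 1) + 1) = (N + 1 + k + 1) by ring]
    ring

theorem raneyNumber_three (r m : ℕ) (hr : 0 < r) :
    raneyNumber 3 r m = r * ((3 * m + r - 1)! : ℝ) / ((m ! : ℝ) * ((2 * m + r)! : ℝ)) := by
  rw [eq_div_iff (by positivity), raneyNumber]
  rcases m with _ | m
  -- At m = 0 the quotient is r (r-1)! / r! = 1; the truncated subtraction is harmless since r > 0.
  · obtain ⟨s, rfl⟩ := Nat.exists_eq_add_of_lt hr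
    simp [Nat.factorial_succ]
  · have h := prod_Icc_sub_mul_factorial (2 * (m + 1) + r) m
    rw [if_neg (by omega), Nat.add_sub_cancel,
      show 3 * (m + 1) + r - 1 = 2 * (m + 1) + r + m by omega, ← h]
    have : ∀ i : ℕ, ((m + 1 : ℕ) : ℝ) * 3 + r - i = ((2 * (m + 1) + r : ℕ) : ℝ) + m + 1 - i := by
      intro i; push_cast; ring
    simp only [this]
    have : ((m + 1)! : ℝ) ≠ 0 := by positivity
    field_simp

/-! ### Beta integrals and the quadratic substitution -/

theorem integrableOn_rpow_mul_one_sub_rpow {a b : ℝ} (ha : -1 < a) (hb : -1 < b) :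
    IntegrableOn (fun t : ℝ => t ^ a * (1 - t) ^ b) (Ioo 0 1) := by
  have h := (Complex.betaIntegral_convergent (u := ((a + 1 : ℝ) : ℂ)) (v := ((b + 1 : ℝ) : ℂ))
    (by rw [Complex.ofReal_re]; linarith) (by rw [Complex.ofReal_re]; linarith))
  rw [intervalIntegrable_iff_integrableOn_Ioo_of_le zero_le_one] at h
  refine (IntegrableOn.congr_fun (MeasureTheory.Integrable.re h) (fun t ht => ?_) measurableSet_Ioo)
  have h1 : (0 : ℝ) ≤ 1 - t := by linarith [ht.2]
  simp only [RCLike.re_to_complex]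
  rw [show ((a + 1 : ℝ) : ℂ) - 1 = (a : ℂ) by push_cast; ring,
    show ((b + 1 : ℝ) : ℂ) - 1 = (b : ℂ) by push_cast; ring,
    show (1 : ℂ) - t = ((1 - t : ℝ) : ℂ) by push_cast; ring,
    ← Complex.ofReal_cpow ht.1.le, ← Complex.ofReal_cpow h1, ← Complex.ofReal_mul,
    Complex.ofReal_re]

theorem integral_rpow_mul_one_sub_rpow {a b : ℝ} (ha : -1 < a) (hb : -1 < b) :
    ∫ t in Ioo (0 : ℝ) 1, t ^ a * (1 - t) ^ b =
      Real.Gamma (a + 1) * Real.Gamma (b + 1) / Real.Gamma (a + b + 2) := by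
  have h := ProbabilityTheory.beta_eq_betaIntegralReal (a + 1) (b + 1) (by linarith) (by linarith)
  rw [ProbabilityTheory.beta, show a + 1 + (b + 1) = a + b + 2 by ring] at h
  rw [h, Complex.betaIntegral, intervalIntegral.integral_of_le zero_le_one,
    integral_Ioc_eq_integral_Ioo, ← Complex.ofReal_re (∫ t in Ioo (0 : ℝ) 1, _),
    ← integral_complex_ofReal]
  congr 1
  refine setIntegral_congr_fun measurableSet_Ioo fun t ht => ?_
  have h1 : (0 : ℝ) ≤ 1 - t := by linarith [ht.2]
  rw [show ((a + 1 : ℝ) : ℂ) - 1 = (a : ℂ) by push_cast; ring,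
    show ((b + 1 : ℝ) : ℂ) - 1 = (b : ℂ) by push_cast; ring,
    show (1 : ℂ) - t = ((1 - t : ℝ) : ℂ) by push_cast; ring,
    ← Complex.ofReal_cpow ht.1.le, ← Complex.ofReal_cpow h1, ← Complex.ofReal_mul]

section Reflection

variable {H : ℝ → ℝ}

theorem integrableOn_add_reflect (hH : IntegrableOn H (Ioo 0 1)) :
    IntegrableOn (fun t => H t + H (1 - t)) (Ioo (1 / 2) 1) ∧
      ∫ t in Ioo (1 / 2 : ℝ) 1, (H t + H (1 - t)) = ∫ t in Ioo (0 : ℝ) 1, H t := by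
  have h01 : IntervalIntegrable H volume 0 1 :=
    (intervalIntegrable_iff_integrableOn_Ioo_of_le zero_le_one).2 hH
  have hl : IntervalIntegrable H volume 0 (1 / 2) :=
    h01.mono_set (by rw [uIcc_of_le, uIcc_of_le] <;> norm_num [Icc_subset_Icc_right])
  have hr : IntervalIntegrable H volume (1 / 2) 1 :=
    h01.mono_set (by rw [uIcc_of_le, uIcc_of_le] <;> norm_num [Icc_subset_Icc_left])
  have hl' : IntervalIntegrable (fun t => H (1 - t)) volume (1 / 2) 1 := by
    have := (hl.comp_sub_left 1).symm
    norm_num at this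
    simpa using this
  refine ⟨(intervalIntegrable_iff_integrableOn_Ioo_of_le (by norm_num)).1 (hr.add hl'), ?_⟩
  rw [← integral_Ioc_eq_integral_Ioo, ← integral_Ioc_eq_integral_Ioo,
    ← intervalIntegral.integral_of_le (by norm_num), ← intervalIntegral.integral_of_le zero_le_one,
    intervalIntegral.integral_add hr hl', intervalIntegral.integral_comp_sub_left]
  norm_num
  rw [add_comm]
  norm_num at hl hr
  exact intervalIntegral.integral_add_adjacent_intervals hl hr

end Reflection

theorem image_quadratic_Ioo :
    (fun t : ℝ => 27 * (t * (1 - t))) '' Ioo (1 / 2) 1 = Ioo 0 (27 / 4) := by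
  ext x
  constructor
  · rintro ⟨t, ⟨h1, h2⟩, rfl⟩
    constructor <;> simp only <;> nlinarith [mul_pos (sub_pos.2 h1) (sub_pos.2 h1)]
  · rintro ⟨h1, h2⟩
    have h3 : 0 < 1 - 4 * x / 27 := by linarith
    have h4 : √(1 - 4 * x / 27) < 1 := by rw [Real.sqrt_lt' one_pos]; linarith
    have h5 := Real.sqrt_pos.2 h3
    have h6 := Real.sq_sqrt h3.le
    refine ⟨(1 + √(1 - 4 * x / 27)) / 2, ⟨by linarith, by linarith⟩, ?_⟩
    simp only
    linear_combination (-27 / 4) * h6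

theorem injOn_quadratic_Ioo : InjOn (fun t : ℝ => 27 * (t * (1 - t))) (Ioo (1 / 2) 1) := by
  intro s hs t ht h
  simp only at h
  have h1 : (s - t) * (s + t - 1) = 0 := by linear_combination (-1 / 27) * h
  rcases mul_eq_zero.1 h1 with h2 | h2
  · linarith
  · linarith [hs.1, ht.1]

/-- Moments of a density which becomes a difference of beta densities under
`x = 27 t (1 - t)`. -/
theorem moments_of_quadratic_subst {f : ℝ → ℝ} {C a b : ℝ} (ha : -1 < a) (hb : -1 < b)
    (hf : ∀ t ∈ Ioo (1 / 2 : ℝ) 1,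
      f (27 * (t * (1 - t))) = C * (t ^ a * (1 - t) ^ b - t ^ b * (1 - t) ^ a)) (m : ℕ) :
    IntegrableOn (fun x => x ^ m * f x) (Ioo 0 (27 / 4)) ∧
      ∫ x in Ioo (0 : ℝ) (27 / 4), x ^ m * f x =
        C * 27 ^ (m + 1) * ((a - b) * (Real.Gamma (m + a + 1) * Real.Gamma (m + b + 1)) /
          Real.Gamma (2 * m + a + b + 3)) := by
  have hm : (0 : ℝ) ≤ m := m.cast_nonneg
  have hderiv : ∀ t ∈ Ioo (1 / 2 : ℝ) 1,
      HasDerivWithinAt (fun t : ℝ => 27 * (t * (1 - t))) (27 * (1 - 2 * t)) (Ioo (1 / 2) 1) t := by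
    intro t _
    have := (((hasDerivAt_id t).mul ((hasDerivAt_id t).const_sub 1)).const_mul 27).hasDerivWithinAt
      (s := Ioo (1 / 2) 1)
    refine this.congr_deriv ?_
    simp only [id]
    ring
  -- H is half of the product of 2t - 1 = t - (1-t) with the antisymmetric weight; the reflection t
  -- ↦ 1 - t supplies the other two terms.
  set H : ℝ → ℝ := fun t =>
    t ^ (m + a + 1) * (1 - t) ^ (m + b) - t ^ (m + a) * (1 - t) ^ (m + b + 1) with hH
  have hI1 := integrableOn_rpow_mul_one_sub_rpow (a := m + a + 1) (b := m + b)
    (by linarith) (by linarith)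
  have hI2 := integrableOn_rpow_mul_one_sub_rpow (a := m + a) (b := m + b + 1)
    (by linarith) (by linarith)
  have hHint : IntegrableOn H (Ioo 0 1) := hI1.sub hI2
  -- Both beta integrals have the same denominator, and Γ(s+1) = s Γ(s) leaves the factor (m+a+1) -
  -- (m+b+1) = a - b.
  have hHval : ∫ t in Ioo (0 : ℝ) 1, H t = (a - b) *
      (Real.Gamma (m + a + 1) * Real.Gamma (m + b + 1)) / Real.Gamma (2 * m + a + b + 3) := by
    rw [hH, integral_sub hI1 hI2,
      integral_rpow_mul_one_sub_rpow (by linarith) (by linarith),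
      integral_rpow_mul_one_sub_rpow (by linarith) (by linarith),
      Real.Gamma_add_one (s := m + a + 1) (by linarith),
      Real.Gamma_add_one (s := m + b + 1) (by linarith),
      show (m : ℝ) + a + 1 + (m + b) + 2 = 2 * m + a + b + 3 by ring,
      show (m : ℝ) + a + (m + b + 1) + 2 = 2 * m + a + b + 3 by ring]
    ring
  have hEq : ∀ t ∈ Ioo (1 / 2 : ℝ) 1,
      |27 * (1 - 2 * t)| • ((27 * (t * (1 - t))) ^ m * f (27 * (t * (1 - t)))) =
        C * 27 ^ (m + 1) * (H t + H (1 - t)) := by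
    intro t ht
    have ht0 : 0 < t := by linarith [ht.1]
    have ht1 : 0 < 1 - t := by linarith [ht.2]
    rw [hf t ht, abs_of_nonpos (by linarith [ht.1]), smul_eq_mul]
    simp only [hH, sub_sub_cancel]
    simp only [Real.rpow_add ht0, Real.rpow_add ht1, Real.rpow_natCast, Real.rpow_one,
      mul_pow]
    ring
  obtain ⟨hadd, hval⟩ := integrableOn_add_reflect hHint
  rw [← image_quadratic_Ioo]
  constructor
  · rw [integrableOn_image_iff_integrableOn_abs_deriv_smul measurableSet_Ioo hderiv
      injOn_quadratic_Ioo]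
    exact IntegrableOn.congr_fun (hadd.const_mul (C * 27 ^ (m + 1)))
      (fun t ht => (hEq t ht).symm) measurableSet_Ioo
  · rw [integral_image_eq_integral_abs_deriv_smul measurableSet_Ioo hderiv
      injOn_quadratic_Ioo, setIntegral_congr_fun measurableSet_Ioo hEq, integral_const_mul, hval,
      hHval]

/-! ### Gamma values at thirds -/

theorem Gamma_third_mul_Gamma_two_thirds :
    Real.Gamma (1 / 3) * Real.Gamma (2 / 3) = 2 * Real.pi / √3 := by
  have h := Real.Gamma_mul_Gamma_one_sub (1 / 3)
  rw [show (1 : ℝ) - 1 / 3 = 2 / 3 by norm_num, show Real.pi * (1 / 3) = Real.pi / 3 by ring,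
    Real.sin_pi_div_three] at h
  rw [h]
  field_simp

/-- Gauss's triplication formula at integers, with m! = Γ(m+1). Each induction step peels three
factors off (3m+3)!; the base case is the reflection formula at 1/3. -/
theorem Gamma_thirds_mul (m : ℕ) :
    27 ^ m * (Real.Gamma (m + 2 / 3) * Real.Gamma (m + 1 / 3)) * (m ! : ℝ) =
      ((3 * m)! : ℝ) * (2 * Real.pi / √3) := by
  induction m with
  | zero => simp [← Gamma_third_mul_Gamma_two_thirds]; ring
  | succ m ih =>
    have hm : (0 : ℝ) ≤ m := m.cast_nonneg
    rw [show ((m + 1 : ℕ) : ℝ) + 2 / 3 = m + 2 / 3 + 1 by push_cast; ring,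
      show ((m + 1 : ℕ) : ℝ) + 1 / 3 = m + 1 / 3 + 1 by push_cast; ring,
      Real.Gamma_add_one (by positivity), Real.Gamma_add_one (by positivity),
      show 3 * (m + 1) = 3 * m + 1 + 1 + 1 by ring, Nat.factorial_succ, Nat.factorial_succ,
      Nat.factorial_succ, Nat.factorial_succ]
    push_cast
    linear_combination (3 * (m : ℝ) + 1) * (3 * m + 2) * (3 * m + 3) * ih

/-! ### From a density to the Raney measure -/

section Density

variable {p r c : ℝ} {f : ℝ → ℝ}

theorem IsRaneyMeasure.eq_of_ae_abs_le {μ ν : Measure ℝ} (hμ : IsRaneyMeasure p r μ)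
    (hν : IsRaneyMeasure p r ν) (h : ∀ᵐ x ∂μ, |x| ≤ c) : μ = ν :=
  haveI := hμ.isProbabilityMeasure
  haveI := hν.isProbabilityMeasure
  eq_of_integral_pow_eq h hν.integrable_pow fun m => by rw [hμ.moment_eq, hν.moment_eq]

/-- The choice in `raneyMeasure` is immaterial: one boundedly supported solution excludes any other.
-/
theorem raneyMeasure_eq {ν : Measure ℝ} (hν : IsRaneyMeasure p r ν)
    (h : ∀ᵐ x ∂ν, |x| ≤ c) : raneyMeasure p r = ν := by
  have hex : ∃ μ : Measure ℝ, IsRaneyMeasure p r μ := ⟨ν, hν⟩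
  rw [raneyMeasure, dif_pos hex]
  exact (hν.eq_of_ae_abs_le hex.choose_spec h).symm

/-- The extension by zero is continuous away from the two endpoints, so the fundamental theorem of
calculus applies there. -/
theorem hasDerivAt_cdf_indicator (hint : IntegrableOn f (Ioo 0 c))
    (hc : ContinuousOn f (Ioo 0 c)) (h0 : ∀ x ∈ Ioo 0 c, 0 ≤ f x) {x : ℝ}
    (hx : x ∉ ({0, c} : Set ℝ)) :
    HasDerivAt (fun t : ℝ =>
      (volume.withDensity fun y => ENNReal.ofReal ((Ioo 0 c).indicator f y)).real (Iic t))
      ((Ioo 0 c).indicator f x) x := by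
  set g := (Ioo 0 c).indicator f with hg
  have hgint : Integrable g := hint.integrable_indicator measurableSet_Ioo
  have hg0 : ∀ y, 0 ≤ g y := fun y => indicator_nonneg h0 y
  have hcdf : ∀ t : ℝ, (volume.withDensity fun y => ENNReal.ofReal (g y)).real (Iic t) =
      (∫ y in Iic x, g y) + ∫ y in x..t, g y := by
    intro t
    rw [measureReal_def, withDensity_apply _ measurableSet_Iic,
      ← integral_eq_lintegral_of_nonneg_ae (.of_forall hg0) hgint.aestronglyMeasurable.restrict,
      ← intervalIntegral.integral_Iic_sub_Iic hgint.integrableOn hgint.integrableOn]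
    ring
  have hcont : ContinuousAt g x := by
    rcases em (x ∈ Ioo 0 c) with hxm | hxm
    · refine (hc.continuousAt (isOpen_Ioo.mem_nhds hxm)).congr ?_
      filter_upwards [isOpen_Ioo.mem_nhds hxm] with y hy
      rw [hg, indicator_of_mem hy]
    · have hxm' : x ∈ (Icc 0 c)ᶜ := by
        simp only [mem_insert_iff, mem_singleton_iff, not_or] at hx
        intro h
        exact hxm ⟨lt_of_le_of_ne h.1 (Ne.symm hx.1), lt_of_le_of_ne h.2 hx.2⟩
      refine (continuousAt_const (y := (0 : ℝ))).congr ?_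
      filter_upwards [isClosed_Icc.isOpen_compl.mem_nhds hxm'] with y hy
      rw [hg, indicator_of_notMem fun h => hy (Ioo_subset_Icc_self h)]
  simp only [hcdf]
  exact (intervalIntegral.integral_hasDerivAt_right (by simp)
    (hgint.aestronglyMeasurable.stronglyMeasurableAtFilter) hcont).const_add _

/-- A continuous density on `(0, c)` with the right moments is the density of `μ(p, r)`. -/
theorem raneyMeasure_of_density (hc : ContinuousOn f (Ioo 0 c)) (h0 : ∀ x ∈ Ioo 0 c, 0 ≤ f x)
    (hint : ∀ m : ℕ, IntegrableOn (fun x => x ^ m * f x) (Ioo 0 c))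
    (hmom : ∀ m : ℕ, ∫ x in Ioo 0 c, x ^ m * f x = raneyNumber p r m) :
    ((∃! μ : Measure ℝ, IsRaneyMeasure p r μ) ∧
      raneyMeasure p r = volume.withDensity (fun x : ℝ => ENNReal.ofReal (raneyDensity p r x)) ∧
      raneyMeasure p r (Ioo 0 c)ᶜ = 0) ∧
    ∀ x ∈ Ioo 0 c, raneyDensity p r x = f x := by
  have hf : IntegrableOn f (Ioo 0 c) := by simpa using hint 0
  set g := (Ioo 0 c).indicator f with hg
  have hgint : Integrable g := hf.integrable_indicator measurableSet_Ioo
  have hg0 : ∀ y, 0 ≤ g y := fun y => indicator_nonneg h0 y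
  have hgm : AEMeasurable (fun y => ENNReal.ofReal (g y)) := hgint.aemeasurable.ennreal_ofReal
  set ν := volume.withDensity fun y => ENNReal.ofReal (g y) with hν
  have hsupp : ν (Ioo 0 c)ᶜ = 0 := by
    rw [hν, withDensity_apply _ measurableSet_Ioo.compl,
      setLIntegral_congr_fun (g := fun _ => 0) measurableSet_Ioo.compl fun y hy => ?_]
    · simp
    · simp only [hg, indicator_of_notMem hy, ENNReal.ofReal_zero]
  have hmul : ∀ m : ℕ, (fun x => (ENNReal.ofReal (g x)).toReal • x ^ m) =
      (Ioo 0 c).indicator fun x => x ^ m * f x := by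
    intro m
    ext x
    rw [ENNReal.toReal_ofReal (hg0 x), hg, smul_eq_mul]
    by_cases hx : x ∈ Ioo 0 c <;> simp [hx, mul_comm]
  have hInt : ∀ m : ℕ, Integrable (fun x : ℝ => x ^ m) ν := by
    intro m
    rw [hν, integrable_withDensity_iff_integrable_smul₀' hgm
      (.of_forall fun _ => ENNReal.ofReal_lt_top), hmul]
    exact (hint m).integrable_indicator measurableSet_Ioo
  have hMom : ∀ m : ℕ, ∫ x, x ^ m ∂ν = raneyNumber p r m := by
    intro m
    rw [hν, integral_withDensity_eq_integral_toReal_smul₀ hgm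
      (.of_forall fun _ => ENNReal.ofReal_lt_top), hmul, integral_indicator measurableSet_Ioo, hmom]
  have hprob : IsProbabilityMeasure ν := by
    have h1 := hMom 0
    simp only [pow_zero, raneyNumber, if_true, integral_const, smul_eq_mul, mul_one] at h1
    exact ⟨by rwa [measureReal_def, ENNReal.toReal_eq_one_iff] at h1⟩
  have hR : IsRaneyMeasure p r ν := ⟨hprob, hInt, hMom⟩
  have hbd : ∀ᵐ x ∂ν, |x| ≤ c := by
    filter_upwards [measure_eq_zero_iff_ae_notMem.1 hsupp] with x hx
    rw [notMem_compl_iff] at hx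
    rw [abs_of_pos hx.1]
    exact hx.2.le
  have heq : raneyMeasure p r = ν := raneyMeasure_eq hR hbd
  have hdens : ∀ x ∉ ({0, c} : Set ℝ), raneyDensity p r x = g x := by
    intro x hx
    rw [raneyDensity, heq]
    exact (hasDerivAt_cdf_indicator hf hc h0 hx).deriv
  refine ⟨⟨⟨ν, hR, fun μ hμ => (hR.eq_of_ae_abs_le hμ hbd).symm⟩, ?_, heq ▸ hsupp⟩, fun x hx => ?_⟩
  · rw [heq]
    refine withDensity_congr_ae ?_
    -- The derivative is unknown only at 0 and c, a null set.
    filter_upwards [(Set.toFinite ({0, c} : Set ℝ)).measure_zero volume |>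
      measure_eq_zero_iff_ae_notMem.1] with x hx
    rw [hdens x hx]
  · rw [hdens x, hg, indicator_of_mem hx]
    simp [hx.1.ne', hx.2.ne]

end Density

/-! ### The explicit densities in the variable t -/

theorem rpow_two_thirds {y : ℝ} (hy : 0 ≤ y) : y ^ (2 / 3 : ℝ) = (y ^ (1 / 3 : ℝ)) ^ 2 := by
  rw [← Real.rpow_natCast, ← Real.rpow_mul hy]
  norm_num

theorem rpow_one_third_pow_three {y : ℝ} (hy : 0 ≤ y) : (y ^ (1 / 3 : ℝ)) ^ 3 = y := by
  rw [← Real.rpow_natCast, ← Real.rpow_mul hy]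
  norm_num

theorem rpow_four_thirds {y : ℝ} (hy : 0 ≤ y) : y ^ (4 / 3 : ℝ) = (y ^ (1 / 3 : ℝ)) ^ 4 := by
  rw [← Real.rpow_natCast, ← Real.rpow_mul hy]
  norm_num

theorem rpow_five_thirds {y : ℝ} (hy : 0 ≤ y) : y ^ (5 / 3 : ℝ) = (y ^ (1 / 3 : ℝ)) ^ 5 := by
  rw [← Real.rpow_natCast, ← Real.rpow_mul hy]
  norm_num

theorem three_rpow_three_halves : (3 : ℝ) ^ (3 / 2 : ℝ) = 3 * √3 := by
  rw [show (3 / 2 : ℝ) = 1 + 1 / 2 by norm_num, Real.rpow_add (by norm_num), Real.rpow_one,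
    Real.sqrt_eq_rpow]

theorem one_add_sqrt_quadratic {t : ℝ} (ht : t ∈ Ioo (1 / 2 : ℝ) 1) :
    1 + √(1 - 4 * (27 * (t * (1 - t))) / 27) = 2 * t := by
  rw [show 1 - 4 * (27 * (t * (1 - t))) / 27 = (2 * t - 1) ^ 2 by ring,
    Real.sqrt_sq (by linarith [ht.1])]
  ring

theorem rpow_one_third_quadratic {t : ℝ} (ht : t ∈ Ioo (1 / 2 : ℝ) 1) :
    (27 * (t * (1 - t))) ^ (1 / 3 : ℝ) = 3 * (t ^ (1 / 3 : ℝ) * (1 - t) ^ (1 / 3 : ℝ)) := by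
  have ht0 : 0 ≤ t := by linarith [ht.1]
  have ht1 : 0 ≤ 1 - t := by linarith [ht.2]
  rw [Real.mul_rpow (by norm_num) (by positivity), Real.mul_rpow ht0 ht1,
    show (27 : ℝ) = 3 ^ (3 : ℝ) by norm_num, ← Real.rpow_mul (by norm_num)]
  norm_num

/-- The density of `μ(3, 1)` on `(0, 27 / 4)`. -/
noncomputable def density₁ (x : ℝ) : ℝ :=
  (3 * (1 + √(1 - 4 * x / 27)) ^ (2 / 3 : ℝ) - (2 : ℝ) ^ (2 / 3 : ℝ) * x ^ (1 / 3 : ℝ)) /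
    ((2 : ℝ) ^ (4 / 3 : ℝ) * (3 : ℝ) ^ (1 / 2 : ℝ) * Real.pi * x ^ (2 / 3 : ℝ) *
      (1 + √(1 - 4 * x / 27)) ^ (1 / 3 : ℝ))

/-- The density of `μ(3, 2)` on `(0, 27 / 4)`. -/
noncomputable def density₂ (x : ℝ) : ℝ :=
  (9 * (1 + √(1 - 4 * x / 27)) ^ (4 / 3 : ℝ) - (2 : ℝ) ^ (4 / 3 : ℝ) * x ^ (2 / 3 : ℝ)) /
    ((2 : ℝ) ^ (5 / 3 : ℝ) * (3 : ℝ) ^ (3 / 2 : ℝ) * Real.pi * x ^ (1 / 3 : ℝ) *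
      (1 + √(1 - 4 * x / 27)) ^ (2 / 3 : ℝ))

theorem density₁_quadratic {t : ℝ} (ht : t ∈ Ioo (1 / 2 : ℝ) 1) :
    density₁ (27 * (t * (1 - t))) = 1 / (6 * √3 * Real.pi) *
      (t ^ (-1 / 3 : ℝ) * (1 - t) ^ (-2 / 3 : ℝ) - t ^ (-2 / 3 : ℝ) * (1 - t) ^ (-1 / 3 : ℝ)) := by
  have ht0 : 0 < t := by linarith [ht.1]
  have ht1 : 0 < 1 - t := by linarith [ht.2]
  have hx : 0 ≤ 27 * (t * (1 - t)) := by positivity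
  rw [density₁, one_add_sqrt_quadratic ht, rpow_two_thirds hx, rpow_one_third_quadratic ht,
    ← Real.sqrt_eq_rpow, rpow_two_thirds (by positivity : (0 : ℝ) ≤ 2 * t),
    Real.mul_rpow two_pos.le ht0.le, rpow_two_thirds two_pos.le, rpow_four_thirds two_pos.le,
    neg_div, neg_div, Real.rpow_neg ht0.le, Real.rpow_neg ht0.le, Real.rpow_neg ht1.le,
    Real.rpow_neg ht1.le, rpow_two_thirds ht0.le, rpow_two_thirds ht1.le]
  have hd := rpow_one_third_pow_three (y := 2) two_pos.le
  have hd0 : 0 < (2 : ℝ) ^ (1 / 3 : ℝ) := by positivity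
  have hT : 0 < t ^ (1 / 3 : ℝ) := by positivity
  have hW : 0 < (1 - t) ^ (1 / 3 : ℝ) := by positivity
  -- In the cube roots T, W, d of t, 1 - t, 2, only a rational identity modulo d^3 = 2 remains.
  generalize t ^ (1 / 3 : ℝ) = T at *
  generalize (1 - t) ^ (1 / 3 : ℝ) = W at *
  generalize (2 : ℝ) ^ (1 / 3 : ℝ) = d at *
  rw [show d ^ 4 = 2 * d by linear_combination d * hd]
  field_simp
  ring

theorem density₂_quadratic {t : ℝ} (ht : t ∈ Ioo (1 / 2 : ℝ) 1) :
    density₂ (27 * (t * (1 - t))) = 1 / (2 * √3 * Real.pi) *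
      (t ^ (1 / 3 : ℝ) * (1 - t) ^ (-1 / 3 : ℝ) - t ^ (-1 / 3 : ℝ) * (1 - t) ^ (1 / 3 : ℝ)) := by
  have ht0 : 0 < t := by linarith [ht.1]
  have ht1 : 0 < 1 - t := by linarith [ht.2]
  have hx : 0 ≤ 27 * (t * (1 - t)) := by positivity
  have h2t : 0 ≤ 2 * t := by positivity
  rw [density₂, one_add_sqrt_quadratic ht, rpow_two_thirds hx, rpow_one_third_quadratic ht,
    three_rpow_three_halves, rpow_two_thirds h2t, rpow_four_thirds h2t,
    Real.mul_rpow two_pos.le ht0.le, rpow_five_thirds two_pos.le, rpow_four_thirds two_pos.le,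
    neg_div, Real.rpow_neg ht0.le, Real.rpow_neg ht1.le]
  have hd := rpow_one_third_pow_three (y := 2) two_pos.le
  have hd0 : 0 < (2 : ℝ) ^ (1 / 3 : ℝ) := by positivity
  have hT : 0 < t ^ (1 / 3 : ℝ) := by positivity
  have hW : 0 < (1 - t) ^ (1 / 3 : ℝ) := by positivity
  generalize t ^ (1 / 3 : ℝ) = T at *
  generalize (1 - t) ^ (1 / 3 : ℝ) = W at *
  generalize (2 : ℝ) ^ (1 / 3 : ℝ) = d at *
  rw [show d ^ 5 = 2 * d ^ 2 by linear_combination d ^ 2 * hd, mul_pow d T 4,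
    show d ^ 4 = 2 * d by linear_combination d * hd]
  field_simp
  linear_combination (-9 : ℝ) * (T ^ 2 - W ^ 2) * hd

/-- Factor out t^b (1-t)^b and use t > 1 - t. -/
theorem rpow_mul_rpow_sub_nonneg {t a b : ℝ} (hab : b ≤ a) (ht : t ∈ Ioo (1 / 2 : ℝ) 1) :
    0 ≤ t ^ a * (1 - t) ^ b - t ^ b * (1 - t) ^ a := by
  have ht0 : 0 < t := by linarith [ht.1]
  have ht1 : 0 < 1 - t := by linarith [ht.2]
  have h : (1 - t) ^ (a - b) ≤ t ^ (a - b) :=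
    Real.rpow_le_rpow ht1.le (by linarith [ht.1]) (by linarith)
  have h1 : t ^ a = t ^ b * t ^ (a - b) := by rw [← Real.rpow_add ht0]; ring_nf
  have h2 : (1 - t) ^ a = (1 - t) ^ b * (1 - t) ^ (a - b) := by
    rw [← Real.rpow_add ht1]; ring_nf
  rw [h1, h2]
  have h3 : 0 ≤ t ^ b * (1 - t) ^ b * (t ^ (a - b) - (1 - t) ^ (a - b)) :=
    mul_nonneg (by positivity) (sub_nonneg.2 h)
  linarith

theorem density₁_nonneg {x : ℝ} (hx : x ∈ Ioo (0 : ℝ) (27 / 4)) : 0 ≤ density₁ x := by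
  rw [← image_quadratic_Ioo] at hx
  obtain ⟨t, ht, rfl⟩ := hx
  simp only
  rw [density₁_quadratic ht]
  exact mul_nonneg (by positivity) (rpow_mul_rpow_sub_nonneg (by norm_num) ht)

theorem density₂_nonneg {x : ℝ} (hx : x ∈ Ioo (0 : ℝ) (27 / 4)) : 0 ≤ density₂ x := by
  rw [← image_quadratic_Ioo] at hx
  obtain ⟨t, ht, rfl⟩ := hx
  simp only
  rw [density₂_quadratic ht]
  exact mul_nonneg (by positivity) (rpow_mul_rpow_sub_nonneg (by norm_num) ht)

theorem continuousOn_density₁ : ContinuousOn density₁ (Ioo 0 (27 / 4)) := by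
  have hs : Continuous fun x : ℝ => 1 + √(1 - 4 * x / 27) := by fun_prop
  refine ContinuousOn.div (Continuous.continuousOn ?_) (Continuous.continuousOn ?_) fun x hx => ?_
  · exact ((hs.rpow_const fun _ => Or.inr (by norm_num)).const_mul _).sub
      ((continuous_id.rpow_const fun _ => Or.inr (by norm_num)).const_mul _)
  · exact ((continuous_id.rpow_const fun _ => Or.inr (by norm_num)).const_mul _).mul
      (hs.rpow_const fun _ => Or.inr (by norm_num))
  · have := hx.1
    positivity

theorem continuousOn_density₂ : ContinuousOn density₂ (Ioo 0 (27 / 4)) := by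
  have hs : Continuous fun x : ℝ => 1 + √(1 - 4 * x / 27) := by fun_prop
  refine ContinuousOn.div (Continuous.continuousOn ?_) (Continuous.continuousOn ?_) fun x hx => ?_
  · exact ((hs.rpow_const fun _ => Or.inr (by norm_num)).const_mul _).sub
      ((continuous_id.rpow_const fun _ => Or.inr (by norm_num)).const_mul _)
  · exact ((continuous_id.rpow_const fun _ => Or.inr (by norm_num)).const_mul _).mul
      (hs.rpow_const fun _ => Or.inr (by norm_num))
  · have := hx.1
    positivity

/-! ### Moments of the densities -/

theorem moments_density₁ (m : ℕ) :
    IntegrableOn (fun x => x ^ m * density₁ x) (Ioo 0 (27 / 4)) ∧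
      ∫ x in Ioo (0 : ℝ) (27 / 4), x ^ m * density₁ x = raneyNumber 3 1 m := by
  obtain ⟨hint, hval⟩ := moments_of_quadratic_subst (by norm_num) (by norm_num)
    (fun t ht => density₁_quadratic ht) m
  refine ⟨hint, ?_⟩
  have hr := raneyNumber_three 1 m one_pos
  have hG := Gamma_thirds_mul m
  rw [Nat.cast_one, Nat.add_sub_cancel, Nat.factorial_succ] at hr
  rw [hval, hr, show (m : ℝ) + -1 / 3 + 1 = m + 2 / 3 by ring,
    show (m : ℝ) + -2 / 3 + 1 = m + 1 / 3 by ring,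
    show 2 * (m : ℝ) + -1 / 3 + -2 / 3 + 3 = ((2 * m + 1 : ℕ) : ℝ) + 1 by push_cast; ring,
    Real.Gamma_nat_eq_factorial, Nat.factorial_succ]
  have h3 : √(3 : ℝ) ^ 2 = 3 := Real.sq_sqrt (by norm_num)
  have hG' : Real.Gamma (m + 2 / 3) * Real.Gamma (m + 1 / 3) =
      ((3 * m)! : ℝ) * (2 * Real.pi / √3) / (27 ^ m * (m ! : ℝ)) := by
    rw [eq_div_iff (by positivity)]
    linear_combination hG
  rw [hG']
  push_cast
  field_simp
  rw [h3]
  ring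

theorem moments_density₂ (m : ℕ) :
    IntegrableOn (fun x => x ^ m * density₂ x) (Ioo 0 (27 / 4)) ∧
      ∫ x in Ioo (0 : ℝ) (27 / 4), x ^ m * density₂ x = raneyNumber 3 2 m := by
  obtain ⟨hint, hval⟩ := moments_of_quadratic_subst (by norm_num) (by norm_num)
    (fun t ht => density₂_quadratic ht) m
  refine ⟨hint, ?_⟩
  have hr := raneyNumber_three 2 m two_pos
  have hG := Gamma_thirds_mul m
  rw [Nat.cast_two, show 3 * m + 2 - 1 = 3 * m + 1 by omega, Nat.factorial_succ] at hr
  rw [hval, hr, show (m : ℝ) + -1 / 3 + 1 = m + 2 / 3 by ring,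
    show (m : ℝ) + 1 / 3 + 1 = m + 1 / 3 + 1 by ring,
    show 2 * (m : ℝ) + 1 / 3 + -1 / 3 + 3 = ((2 * m + 2 : ℕ) : ℝ) + 1 by push_cast; ring,
    Real.Gamma_nat_eq_factorial, Real.Gamma_add_one (by positivity)]
  have h3 : √(3 : ℝ) ^ 2 = 3 := Real.sq_sqrt (by norm_num)
  -- The extra factor m + 1/3 comes from Γ(m + 4/3) and accounts for the 3m + 1 in (3m+1)!.
  have hG' : (m + 1 / 3) * Real.Gamma (m + 1 / 3) * Real.Gamma (m + 2 / 3) =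
      (m + 1 / 3) * (((3 * m)! : ℝ) * (2 * Real.pi / √3) / (27 ^ m * (m ! : ℝ))) := by
    rw [← mul_div_assoc, eq_div_iff (by positivity)]
    linear_combination (m + 1 / 3 : ℝ) * hG
  rw [hG']
  push_cast
  field_simp
  rw [h3]
  ring

/-- Multiplying a density by x shifts its moments by one, so this shift gives the case r = 3. -/
theorem raneyNumber_three_three (m : ℕ) : raneyNumber 3 3 m = raneyNumber 3 1 (m + 1) := by
  have h1 := raneyNumber_three 1 (m + 1) one_pos
  have h3 := raneyNumber_three 3 m three_pos
  rw [Nat.cast_one] at h1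
  rw [Nat.cast_ofNat] at h3
  rw [h1, h3, show 3 * (m + 1) + 1 - 1 = 3 * m + 2 + 1 by omega,
    show 3 * m + 3 - 1 = 3 * m + 2 by omega, show 2 * (m + 1) + 1 = 2 * m + 3 by ring,
    Nat.factorial_succ (3 * m + 2), Nat.factorial_succ m]
  have : (m : ℝ) + 1 ≠ 0 := by positivity
  push_cast
  field_simp
  ring

theorem mainTheorem7 :
    (∀ r ∈ ({1, 2, 3} : Set ℝ),
      (∃! μ : Measure ℝ, IsRaneyMeasure 3 r μ) ∧
      raneyMeasure 3 r = volume.withDensity (fun x : ℝ => ENNReal.ofReal (raneyDensity 3 r x)) ∧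
      raneyMeasure 3 r (Ioo (0 : ℝ) (27 / 4))ᶜ = 0) ∧
    ∀ x ∈ Ioo (0 : ℝ) (27 / 4),
      raneyDensity 3 1 x =
        (3 * (1 + √(1 - 4 * x / 27)) ^ (2 / 3 : ℝ) - (2 : ℝ) ^ (2 / 3 : ℝ) * x ^ (1 / 3 : ℝ)) /
          ((2 : ℝ) ^ (4 / 3 : ℝ) * (3 : ℝ) ^ (1 / 2 : ℝ) * Real.pi * x ^ (2 / 3 : ℝ) *
            (1 + √(1 - 4 * x / 27)) ^ (1 / 3 : ℝ)) ∧
      raneyDensity 3 2 x =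
        (9 * (1 + √(1 - 4 * x / 27)) ^ (4 / 3 : ℝ) - (2 : ℝ) ^ (4 / 3 : ℝ) * x ^ (2 / 3 : ℝ)) /
          ((2 : ℝ) ^ (5 / 3 : ℝ) * (3 : ℝ) ^ (3 / 2 : ℝ) * Real.pi * x ^ (1 / 3 : ℝ) *
            (1 + √(1 - 4 * x / 27)) ^ (2 / 3 : ℝ)) ∧
      raneyDensity 3 3 x = x * raneyDensity 3 1 x := by
  obtain ⟨h1, d1⟩ := raneyMeasure_of_density continuousOn_density₁ (fun _ => density₁_nonneg)
    (fun m => (moments_density₁ m).1) (fun m => (moments_density₁ m).2)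
  obtain ⟨h2, d2⟩ := raneyMeasure_of_density continuousOn_density₂ (fun _ => density₂_nonneg)
    (fun m => (moments_density₂ m).1) (fun m => (moments_density₂ m).2)
  have hpow : ∀ m : ℕ, (fun x => x ^ m * (x * density₁ x)) = fun x => x ^ (m + 1) * density₁ x :=
    fun m => funext fun x => by ring
  obtain ⟨h3, d3⟩ := raneyMeasure_of_density (p := 3) (r := 3) (f := fun x => x * density₁ x)
    (continuousOn_id.mul continuousOn_density₁)
    (fun x hx => mul_nonneg hx.1.le (density₁_nonneg hx))
    (fun m => by rw [hpow]; exact (moments_density₁ (m + 1)).1)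
    (fun m => by rw [hpow, raneyNumber_three_three]; exact (moments_density₁ (m + 1)).2)
  refine ⟨?_, fun x hx => ⟨d1 x hx, d2 x hx, by rw [d3 x hx, d1 x hx]⟩⟩
  rintro r (rfl | rfl | rfl)
  exacts [h1, h2, h3]
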